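/- Let $X\subseteq\{0,1\}^*$ be a set of words whose membership problem is decidable in polynomial time, and let $X_n:=X\cap\{0,1\}^n$. Let $\mathcal P=(X,\preccurlyeq)$ be a poset such that $x\preccurlyeq y$ only if $x,y\in X_n$ for some $n$. Suppose that (1) $\mathcal P$ has polynomial height: there are constants $C,c>0$ such that for all $n\ge 1$ every chain in $(X_n,\preccurlyeq)$ has at most $C\,n^c$ elements; (2) the incidence function of $\mathcal P$ (given by $\xi(x,y)=1$ if $x\preccurlyeq y$ and $\xi(x,y)=0$ otherwise) is poly-time computable: there is a Turing machine which, given $x,y\in X_n$ for some $n$, decides whether $x\preccurlyeq y$ in time polynomial in the size of the input. Let $\mu$ be the Möbius inverse function of $\mathcal P$, i.e. the integer function with $$\sum_{z\in X_n}\xi(x,z)\,\mu(z,y)=\begin{cases}1 & \text{if } x=y,\\ 0 & \text{if } x\ne y,\end{cases}\qquad\text{for all } n \text{ and all } x,y\in X_n,$$ extended by $\mu(x,y)=0$ for all other pairs of words $(x,y)$. Then $\mu$ is in $\mathsf{GapP}=\#\mathsf P-\#\mathsf P$, that is, $\mu=g-h$ for two functions $g,h:\{0,1\}^*\times\{0,1\}^*\to\mathbb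 N$ in $\#\mathsf P$. Here a function $g$ is in $\#\mathsf P$ if $g(x,y)=\#\{u\in\{0,1\}^* : (x,y,u)\in B\}$ for a polynomial-time decidable relation $B$ such that, for some polynomial $p$, $(x,y,u)\in B$ implies $|u|\le p(|x|+|y|)$. -/

import Mathlib

namespace EffectiveMoebius

/-- Words over the alphabet `{0, 1}`; the size of a word is its length. -/
abbrev Word : Type := List Bool

/-! ### Polynomial time, `#P` and `GapP` -/

/-- A tuple of words as an input string over the alphabet `{0, 1, #}`: every word is followed by
the separator `#`, which is `none`. -/
def encodeWords (ws : List Word) : List (Option Bool) :=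
  ws.flatMap fun w => w.map some ++ [none]

open Classical in
/-- The decision problem `R` on the instances `a : α`, each of which is presented as the tuple of
words `code a`, is solved by a (multi-stack) Turing machine, in time polynomial in the length of
the input. If `α` is a subtype, nothing is asked of the machine on other inputs. -/
def PolyTimeDecidable {α : Type} (code : α → List Word) (R : α → Prop) : Prop :=
  Nonempty (Turing.TM2ComputableInPolyTime (fun a => encodeWords (code a))
    Computability.encodeBool (fun a => decide (R a)))

/-- `f` is in `#P`: it counts the witnesses of a polynomial-time decidable relation whose
witnesses have length polynomial in the length of the input. -/
def InSharpP {α : Type} (code : α → List Word) (f : α → ℕ) : Prop :=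
  ∃ (B : α → Word → Prop) (p : Polynomial ℕ),
    PolyTimeDecidable (fun q : α × Word => code q.1 ++ [q.2]) (fun q => B q.1 q.2) ∧
    (∀ a u, B a u → u.length ≤ p.eval (encodeWords (code a)).length) ∧
    ∀ a, f a = {u | B a u}.ncard

/-- `GapP = #P - #P`. -/
def InGapP {α : Type} (code : α → List Word) (f : α → ℤ) : Prop :=
  ∃ g h : α → ℕ, InSharpP code g ∧ InSharpP code h ∧ ∀ a, f a = (g a : ℤ) - (h a : ℤ)

/-! ### Posets of words -/

/-- A partial order `le` on a set `carrier` of words, in which comparable words have the same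
length. The relation `le` is a set of pairs of elements of `carrier`: it never holds for a word
outside `carrier`. -/
structure WordPoset where
  carrier : Set Word
  le : Word → Word → Prop
  mem_left : ∀ {x y}, le x y → x ∈ carrier
  mem_right : ∀ {x y}, le x y → y ∈ carrier
  length_eq : ∀ {x y}, le x y → x.length = y.length
  refl : ∀ {x}, x ∈ carrier → le x x
  antisymm : ∀ {x y}, le x y → le y x → x = y
  trans : ∀ {x y z}, le x y → le y z → le x z

namespace WordPoset

variable (P : WordPoset)

/-- The elements of length `n`. -/
def level (n : ℕ) : Set Word := {x | x ∈ P.carrier ∧ x.length = n}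

theorem level_finite (n : ℕ) : (P.level n).Finite :=
  (List.finite_length_eq Bool n).subset fun _ hx => hx.2

/-- The height of the subposet of elements of length `n`: the largest number of elements of
a chain. -/
noncomputable def height (n : ℕ) : ℕ :=
  sSup {k | ∃ s : Finset Word, (s : Set Word) ⊆ P.level n ∧ IsChain P.le (s : Set Word) ∧
    s.card = k}

/-- The supremum in the definition of `height` is attained. -/
theorem isGreatest_height (n : ℕ) :
    IsGreatest {k | ∃ s : Finset Word, (s : Set Word) ⊆ P.level n ∧
      IsChain P.le (s : Set Word) ∧ s.card = k} (P.height n) := by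
  have hb : BddAbove {k | ∃ s : Finset Word, (s : Set Word) ⊆ P.level n ∧
      IsChain P.le (s : Set Word) ∧ s.card = k} := by
    refine ⟨(P.level_finite n).toFinset.card, ?_⟩
    rintro k ⟨s, hs, -, rfl⟩
    exact Finset.card_le_card fun x hx => (P.level_finite n).mem_toFinset.2 (hs hx)
  exact ⟨Nat.sSup_mem ⟨0, ∅, by simp, by simp [IsChain], rfl⟩ hb, fun k hk => le_csSup hb hk⟩

/-- The height of the elements of length `n ≥ 1` is at most `C * n ^ c`. -/
def HasPolynomialHeight : Prop :=
  ∃ C c : ℕ, ∀ n, 1 ≤ n → P.height n ≤ C * n ^ c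

/-- Membership in the underlying set is decidable in polynomial time. -/
def PolyTimeMembership : Prop :=
  PolyTimeDecidable (fun w : Word => [w]) (fun w => w ∈ P.carrier)

/-- Whether `x ≼ y` is decidable in polynomial time for `x` and `y` that are promised to be elements
of the poset of the same length. -/
def PolyTimeIncidence : Prop :=
  PolyTimeDecidable
    (fun q : {q : Word × Word // ∃ n, q.1 ∈ P.level n ∧ q.2 ∈ P.level n} => [q.1.1, q.1.2])
    (fun q => P.le q.1.1 q.1.2)

open Classical in
/-- The incidence function of the poset. -/
noncomputable def incidence (x y : Word) : ℤ := if P.le x y then 1 else 0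

/-- `μ` is the Möbius inverse of the poset: `∑ z, ξ x z * μ z y = δ x y`, both `z` in the sum and
`x, y` ranging over the elements of one length. It is extended by `0` to all other pairs of
words. -/
def IsMoebiusInverse (μ : Word → Word → ℤ) : Prop :=
  (∀ n, ∀ x ∈ P.level n, ∀ y ∈ P.level n,
    ∑ᶠ z ∈ P.level n, P.incidence x z * μ z y = if x = y then 1 else 0) ∧
  ∀ x y, (¬ ∃ n, x ∈ P.level n ∧ y ∈ P.level n) → μ x y = 0

open Classical in
/-- The zeta matrix of a finite poset has a right inverse. -/
theorem exists_zeta_inverse (α : Type) [Fintype α] [PartialOrder α] : ∃ ν : α → α → ℤ, ∀ x y,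
    ∑ z, (if x ≤ z then 1 else 0) * ν z y = if x = y then 1 else 0 := by
  let lf : LocallyFiniteOrder α := Fintype.toLocallyFiniteOrder
  have h := IncidenceAlgebra.zeta_mul_mu (𝕜 := ℤ) (α := α)
  refine ⟨fun x y => IncidenceAlgebra.mu ℤ x y, fun x y => ?_⟩
  have h2 := congrArg (fun f => f x y) h
  simp only [IncidenceAlgebra.mul_apply, IncidenceAlgebra.one_apply,
    IncidenceAlgebra.zeta_apply] at h2
  rw [← h2]
  symm
  apply Finset.sum_subset (Finset.subset_univ _)
  intro z _ hz
  simp only [Finset.mem_Icc, not_and] at hz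
  by_cases hx : x ≤ z
  · rw [IncidenceAlgebra.apply_eq_zero_of_not_le (hz hx), mul_zero]
  · simp [hx]

open Classical in
/-- The Möbius inverse exists. -/
theorem exists_isMoebiusInverse : ∃ μ, P.IsMoebiusInverse μ := by
  have key : ∀ n, ∃ ν : P.level n → P.level n → ℤ, ∀ x y : P.level n,
      ∑ᶠ z : P.level n, P.incidence x z * ν z y = if x = y then 1 else 0 := by
    intro n
    have : Fintype (P.level n) := (P.level_finite n).fintype
    let o : PartialOrder (P.level n) :=
      { le := fun x y => P.le x y
        lt := fun x y => P.le x y ∧ ¬ P.le y x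
        lt_iff_le_not_ge := fun _ _ => Iff.rfl
        le_refl := fun x => P.refl x.2.1
        le_trans := fun _ _ _ => P.trans
        le_antisymm := fun _ _ h h' => Subtype.ext (P.antisymm h h') }
    obtain ⟨ν, hν⟩ := @exists_zeta_inverse (P.level n) _ o
    refine ⟨ν, fun x y => ?_⟩
    rw [finsum_eq_sum_of_fintype]
    convert hν x y
    rfl
  choose ν hν using key
  refine ⟨fun x y => if h : x ∈ P.level x.length ∧ y ∈ P.level x.length then
    ν x.length ⟨x, h.1⟩ ⟨y, h.2⟩ else 0, ?_, ?_⟩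
  · intro n x hx y hy
    have := hν n ⟨x, hx⟩ ⟨y, hy⟩
    rw [finsum_mem_eq_finite_toFinset_sum _ (P.level_finite n)]
    have : Fintype (P.level n) := (P.level_finite n).fintype
    rw [finsum_eq_sum_of_fintype] at *
    simp only [Subtype.mk.injEq] at *
    rw [← this]
    symm
    refine Finset.sum_bij' (fun z _ => z.1) (fun z hz => ⟨z, by simpa using hz⟩)
       ?_ ?_ ?_ ?_ ?_ <;> simp
    rintro z hz
    have hl : z.length = n := hz.2
    subst hl
    simp [hz, hy]
  · intro x y h
    exact dif_neg fun h' => h ⟨_, h'⟩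

/-- The Möbius inverse is unique. -/
theorem isMoebiusInverse_unique {μ ν : Word → Word → ℤ} (h : P.IsMoebiusInverse μ)
    (h' : P.IsMoebiusInverse ν) : μ = ν := by
  classical
  funext x y
  by_cases hxy : ∃ n, x ∈ P.level n ∧ y ∈ P.level n
  · obtain ⟨n, hx, hy⟩ := hxy
    have : Fintype (P.level n) := (P.level_finite n).fintype
    let M : (Word → Word → ℤ) → Matrix (P.level n) (P.level n) ℤ := fun f a b => f a b
    have key : ∀ ρ, P.IsMoebiusInverse ρ → M P.incidence * M ρ = 1 := by
      intro ρ hρ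
      ext a b
      have := hρ.1 n a a.2 b b.2
      rw [finsum_mem_eq_finite_toFinset_sum _ (P.level_finite n)] at this
      rw [Matrix.mul_apply, Matrix.one_apply]
      simp only [Subtype.ext_iff]
      rw [← this]
      refine Finset.sum_bij' (fun z _ => z.1) (fun z hz => ⟨z, by simpa using hz⟩)
       ?_ ?_ ?_ ?_ ?_ <;> simp [M]
    have e1 := key μ h
    have e2 := _root_.mul_eq_one_comm.1 (key ν h')
    have : M ν = M μ := by
      calc M ν = M ν * (M P.incidence * M μ) := by rw [e1, mul_one]
        _ = M μ := by rw [← mul_assoc, e2, one_mul]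
    exact (congrFun (congrFun this ⟨x, hx⟩) ⟨y, hy⟩).symm
  · rw [h.2 x y hxy, h'.2 x y hxy]

end WordPoset

end EffectiveMoebius

/-!
By Philip Hall's theorem, `μ x y` is the number of strict chains `x = z₀ < z₁ < ⋯ < z_k = y` with
`k` even minus the number of those with `k` odd: both sides satisfy the recursion that is obtained
by splitting off the first step of a chain, and the Möbius inverse is unique. So it is enough to
show that each of the two numbers of chains is a function in `#P`.

The witness of a chain is the word `z₁ ++ ⋯ ++ z_k` (`WordPoset.CodesChain`). As comparable words
have the same length, a chain is determined by its endpoint `x` and its witness: the blocks have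
length `|x|`. (If `|x| = 0`, there is only the trivial chain, with witness `[]`.) Polynomial height
bounds the length of the witnesses (`CodesChain.length_le`), and Hall's theorem is
`WordPoset.isMoebiusInverse_chainCount`.

It remains to recognize the witnesses by a Turing machine in polynomial time
(`WordPoset.polyTimeDecidable_codesChain`). The machine `ChainMachine.machine` contains the given
machines for membership and for the order as subroutines, which run on stacks of their own; since
such a machine halts with all stacks empty, except for its output, it can be called again and
again. The machine reads the witness block by block. For every block `z` it first calls the
membership test, and only if `z` belongs to the poset does it ask whether the previous element lies
below `z`, because the second subroutine is only promised to work on elements of the poset. The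
running time is bounded backwards: `ChainMachine.Decides t T c b` says that the configuration `c`
leads to the answer `b` within `T` steps, and every lemma about a loop of the machine turns such a
bound after the loop into one before it.
-/

namespace EffectiveMoebius

/-! ### Chains and the Möbius function -/

namespace WordPoset

variable (P : WordPoset)

/-- `P.CodesChain p x y u` says that the word `u` codes a strict chain `x < z₁ < ⋯ < z_k = y` of
elements of `P`, that is, `u = z₁ ++ ⋯ ++ z_k`, and that `k` is even if and only if `p = true`.
The least element `x` is left out of `u`, so that the trivial chain `x = y` has the code `[]`. -/
inductive CodesChain : Bool → Word → Word → Word → Prop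
  | nil {x : Word} (hx : x ∈ P.carrier) : CodesChain true x x []
  | cons {p : Bool} {x z y u : Word} (hle : P.le x z) (hne : x ≠ z) (h : CodesChain p z y u) :
      CodesChain (!p) x y (z ++ u)

variable {P}

namespace CodesChain

theorem left_mem {p : Bool} {x y u : Word} (h : P.CodesChain p x y u) : x ∈ P.carrier := by
  cases h with
  | nil hx => exact hx
  | cons hle => exact P.mem_left hle

theorem le {p : Bool} {x y u : Word} (h : P.CodesChain p x y u) : P.le x y := by
  induction h with
  | nil hx => exact P.refl hx
  | cons hle _ _ ih => exact P.trans hle ih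

/-- The elements of a coded chain form a chain of `P`; the code has one block for each of them,
except for the least one. -/
theorem exists_isChain {p : Bool} {x y u : Word} (h : P.CodesChain p x y u) :
    ∃ s : Finset Word, (s : Set Word) ⊆ P.level x.length ∧ IsChain P.le (s : Set Word) ∧
      (∀ w ∈ s, P.le x w) ∧ u.length + x.length = s.card * x.length := by
  classical
  induction h with
  | @nil x hx =>
    refine ⟨{x}, ?_, ?_, ?_, ?_⟩
    · simpa using (show x ∈ P.level x.length from ⟨hx, rfl⟩)
    · simp
    · simpa using P.refl hx
    · simp
  | @cons p x z y u hle hne h ih =>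
    obtain ⟨s, hs, hc, hz, hcard⟩ := ih
    have hl := P.length_eq hle
    have hxs : x ∉ s := fun hx => hne (P.antisymm hle (hz x hx))
    refine ⟨insert x s, ?_, ?_, ?_, ?_⟩
    · rw [Finset.coe_insert, Set.insert_subset_iff, hl]
      exact ⟨⟨P.mem_left hle, hl⟩, hs⟩
    · rw [Finset.coe_insert]
      exact hc.insert fun b hb _ => Or.inl (P.trans hle (hz b hb))
    · intro w hw
      rcases Finset.mem_insert.1 hw with rfl | hw
      · exact P.refl (P.mem_left hle)
      · exact P.trans hle (hz w hw)
    · rw [Finset.card_insert_of_notMem hxs, List.length_append, add_mul, hl, ← hcard]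
      ring

theorem length_le {p : Bool} {x y u : Word} (h : P.CodesChain p x y u) :
    u.length ≤ P.height x.length * x.length := by
  obtain ⟨s, hs, hc, -, hcard⟩ := h.exists_isChain
  have := (P.isGreatest_height x.length).2 ⟨s, hs, hc, rfl⟩
  have := Nat.mul_le_mul_right x.length this
  omega

end CodesChain

theorem codesChain_nil_iff {p : Bool} {x y : Word} :
    P.CodesChain p x y [] ↔ p = true ∧ x = y ∧ x ∈ P.carrier := by
  constructor
  · intro h
    generalize hu : ([] : Word) = u at h
    cases h with
    | nil hx => exact ⟨rfl, rfl, hx⟩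
    | @cons p x z y u hle hne h =>
      have hz : z = [] := by simp_all
      have hx : x = [] := by
        have := P.length_eq hle
        rw [hz] at this
        exact List.length_eq_zero_iff.1 this
      exact absurd (hx.trans hz.symm) hne
  · rintro ⟨rfl, rfl, hx⟩
    exact .nil hx

/-- The first block of a nonempty code is found by its length, which is that of `x`. -/
theorem codesChain_iff_of_ne_nil {p : Bool} {x y u : Word} (hu : u ≠ []) :
    P.CodesChain p x y u ↔ P.le x (u.take x.length) ∧ x ≠ u.take x.length ∧
      P.CodesChain (!p) (u.take x.length) y (u.drop x.length) := by
  constructor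
  · intro h
    cases h with
    | nil => exact absurd rfl hu
    | cons hle hne h =>
      have hl := P.length_eq hle
      rw [hl, List.take_left, List.drop_left, Bool.not_not]
      exact ⟨hle, hne, h⟩
  · rintro ⟨hle, hne, h⟩
    have := CodesChain.cons hle hne h
    rwa [Bool.not_not, List.take_append_drop] at this

theorem finite_codesChain (p : Bool) (x y : Word) : {u | P.CodesChain p x y u}.Finite :=
  (List.finite_length_le Bool (P.height x.length * x.length)).subset fun _ h => h.length_le

variable (P)

/-- The number of strict chains from `x` to `y` whose number of steps is even (`p = true`) or odd
(`p = false`). -/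
noncomputable def chainCount (p : Bool) (x y : Word) : ℕ := {u | P.CodesChain p x y u}.ncard

open Classical in
/-- A chain from `x` is trivial or is a step to some `z > x` followed by a chain from `z`. -/
theorem chainCount_eq (p : Bool) {x : Word} (hx : x ∈ P.carrier) (y : Word) :
    P.chainCount p x y = (if p = true ∧ x = y then 1 else 0) +
      ∑ z ∈ (P.level_finite x.length).toFinset with P.le x z ∧ x ≠ z, P.chainCount (!p) z y := by
  have hset : (finite_codesChain (P := P) p x y).toFinset =
      (if p = true ∧ x = y then {[]} else ∅) ∪
        ((P.level_finite x.length).toFinset.filter fun z => P.le x z ∧ x ≠ z).biUnion fun z =>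
          (finite_codesChain (P := P) (!p) z y).toFinset.image (z ++ ·) := by
    ext u
    simp only [Set.Finite.mem_toFinset, Set.mem_ofPred_eq, Finset.mem_union, Finset.mem_biUnion,
      Finset.mem_filter, Finset.mem_image]
    constructor
    · intro h
      cases h with
      | nil hx => simp
      | @cons p x z y u hle hne h =>
        refine Or.inr ⟨z, ⟨⟨P.mem_right hle, (P.length_eq hle).symm⟩, hle, hne⟩, u, ?_, rfl⟩
        rwa [Bool.not_not]
    · rintro (h | ⟨z, ⟨-, hle, hne⟩, u, h, rfl⟩)
      · split_ifs at h with hp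
        · obtain ⟨rfl, rfl⟩ := hp
          rw [Finset.mem_singleton.1 h]
          exact .nil hx
        · simp at h
      · simpa using CodesChain.cons hle hne h
  have hdisj : Disjoint (if p = true ∧ x = y then ({[]} : Finset Word) else ∅)
      (((P.level_finite x.length).toFinset.filter fun z => P.le x z ∧ x ≠ z).biUnion fun z =>
          (finite_codesChain (P := P) (!p) z y).toFinset.image (z ++ ·)) := by
    rw [Finset.disjoint_left]
    intro u hu
    have hu : u = [] := by
      split_ifs at hu
      · simpa using hu
      · simp at hu
    subst hu
    simp only [Finset.mem_biUnion, Finset.mem_filter, Finset.mem_image, not_exists, not_and]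
    rintro z ⟨-, hle, hne⟩ u - h
    have hz : z = [] := (List.append_eq_nil_iff.1 h).1
    subst hz
    exact hne (List.length_eq_zero_iff.1 (P.length_eq hle))
  rw [chainCount, Set.ncard_eq_toFinset_card _ (finite_codesChain p x y), hset,
    Finset.card_union_of_disjoint hdisj, Finset.card_biUnion]
  · congr 1
    · split_ifs <;> rfl
    · refine Finset.sum_congr rfl fun z _ => ?_
      rw [Finset.card_image_of_injective _ fun a b h => List.append_cancel_left h, chainCount,
        Set.ncard_eq_toFinset_card _ (finite_codesChain (!p) z y)]
  · intro z hz z' hz' hzz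
    rw [Function.onFun, Finset.disjoint_left]
    intro u hu hu'
    obtain ⟨a, -, rfl⟩ := Finset.mem_image.1 hu
    obtain ⟨b, -, h⟩ := Finset.mem_image.1 hu'
    have hl : z'.length = z.length := by
      rw [← P.length_eq (Finset.mem_filter.1 hz).2.1, P.length_eq (Finset.mem_filter.1 hz').2.1]
    exact hzz (List.append_inj_left h hl).symm

/-- Philip Hall's theorem: the Möbius function counts strict chains with signs. -/
theorem isMoebiusInverse_chainCount :
    P.IsMoebiusInverse fun x y => (P.chainCount true x y : ℤ) - P.chainCount false x y := by
  classical
  constructor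
  · intro n x hx y hy
    obtain ⟨hx, rfl⟩ := hx
    have e : ∀ p, (P.chainCount p x y : ℤ) = (if p = true ∧ x = y then 1 else 0) +
        ∑ z ∈ (P.level_finite x.length).toFinset with P.le x z ∧ x ≠ z,
          (P.chainCount (!p) z y : ℤ) := fun p => by
      rw [P.chainCount_eq p hx y]
      push_cast
      rfl
    have hsplit : (P.level_finite x.length).toFinset.filter (fun z => P.le x z) =
        insert x ((P.level_finite x.length).toFinset.filter fun z => P.le x z ∧ x ≠ z) := by
      ext z
      by_cases hz : x = z
      · subst hz
        simp [hx, P.refl hx, level]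
      · simp [hz, Ne.symm hz]
    rw [finsum_mem_eq_finite_toFinset_sum _ (P.level_finite _)]
    simp only [incidence, ite_mul, one_mul, zero_mul]
    rw [← Finset.sum_filter, hsplit, Finset.sum_insert (by simp), e true, e false,
      Finset.sum_sub_distrib]
    simp
  · intro x y h
    have h0 : ∀ p, P.chainCount p x y = 0 := by
      intro p
      rw [chainCount, Set.ncard_eq_zero (finite_codesChain p x y), Set.eq_empty_iff_forall_notMem]
      intro u hu
      have hle := CodesChain.le hu
      exact h ⟨x.length, ⟨P.mem_left hle, rfl⟩, P.mem_right hle, (P.length_eq hle).symm⟩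
    simp [h0]

end WordPoset

/-! ### The machine that recognizes codes of chains -/

open Turing

namespace ChainMachine

instance (tm : FinTM2) : Fintype tm.K := tm.kFin
instance (tm : FinTM2) : Fintype tm.Λ := tm.ΛFin
instance (tm : FinTM2) : Fintype tm.σ := tm.σFin

/-- The stacks of words of the calling machine: `y` holds the upper end of the chain, `c` the
current element, `r` and `z` the part of the current element and of the next block that has been
read, and `out` the answer. On `y`, `r` and `z` the last letter of the word is on top. -/
inductive Stk
  | y | c | r | z | out
  deriving DecidableEq

instance : Fintype Stk := ⟨{.y, .c, .r, .z, .out}, fun k => by cases k <;> decide⟩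

/-- The labels of the calling machine, one for each of its loops and one for each place that a
subroutine returns to. -/
inductive Lab
  | readX | readY | copyZ | copyR | retMem | retInc | head | block | revC | compare | clean
  deriving DecidableEq

instance : Fintype Lab :=
  ⟨{.readX, .readY, .copyZ, .copyR, .retMem, .retInc, .head, .block, .revC, .compare, .clean},
    fun k => by cases k <;> decide⟩

/-- The registers of the calling machine: `a`, `b`, `b'` and `more` are scratch registers, reset
at the end of every step; `par` and `flag` survive. -/
structure Reg where
  a : Option (Option Bool) := none
  b : Option Bool := none
  b' : Option Bool := none
  more : Bool := false
  par : Bool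
  flag : Bool
  deriving Fintype

variable (A : Bool → TM2ComputableAux (Option Bool) Bool)

/-- The stacks of the calling machine and of its two subroutines; `Sum.inl none` is the input
stack. -/
abbrev Idx : Type := Option Stk ⊕ Σ i, (A i).tm.K

/-- The stack alphabets. -/
abbrev Alph : Idx A → Type
  | .inl none => Option Bool
  | .inl (some _) => Bool
  | .inr k => (A k.1).tm.Γ k.2

/-- The labels of the calling machine and of its two subroutines. -/
abbrev Label : Type := Lab ⊕ Σ i, (A i).tm.Λ

/-- The registers of the calling machine and the internal states of its two subroutines. -/
abbrev State : Type := Reg × ∀ i, (A i).tm.σ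

/-- Statements of the whole machine. -/
abbrev Code : Type := TM2.Stmt (Alph A) (Label A) (State A)

variable {A}

/-- Where the subroutine `i` returns to. -/
def ret : Bool → Lab
  | true => .retMem
  | false => .retInc

/-- The code of the subroutine `i` as code of the whole machine: instead of halting, it
returns. -/
def embed (i : Bool) : TM2.Stmt (A i).tm.Γ (A i).tm.Λ (A i).tm.σ → Code A
  | .push k f q => .push (.inr ⟨i, k⟩) (fun v => f (v.2 i)) (embed i q)
  | .peek k f q => .peek (.inr ⟨i, k⟩)
      (fun v s => (v.1, Function.update v.2 i (f (v.2 i) s))) (embed i q)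
  | .pop k f q => .pop (.inr ⟨i, k⟩)
      (fun v s => (v.1, Function.update v.2 i (f (v.2 i) s))) (embed i q)
  | .load f q => .load (fun v => (v.1, Function.update v.2 i (f (v.2 i)))) (embed i q)
  | .branch f q₁ q₂ => .branch (fun v => f (v.2 i)) (embed i q₁) (embed i q₂)
  | .goto f => .goto fun v => .inr ⟨i, f (v.2 i)⟩
  | .halt => .goto fun _ => .inl (ret i)

/-- Load the two lasting registers, reset the others, and go to `l`. -/
def jump (par flag : Reg → Bool) (l : Label A) : Code A :=
  .load (fun v => ({ par := par v.1, flag := flag v.1 }, v.2)) (.goto fun _ => l)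

/-- Go to `l`, keeping the two lasting registers. -/
def next (l : Lab) : Code A := jump Reg.par Reg.flag (.inl l)

/-- Call the subroutine `i`. -/
def call (i : Bool) : Code A := jump Reg.par Reg.flag (.inr ⟨i, (A i).tm.main⟩)

/-- Clean up, with the answer "no". -/
def reject : Code A := jump Reg.par (fun _ => false) (.inl .clean)

/-- Pop a symbol of the input into the register `a`. -/
def popInput (q : Code A) : Code A :=
  .pop (.inl none) (fun v s => ({ v.1 with a := s }, v.2)) q

/-- Pop a bit from the stack `k` into the register `b`. -/
def popB (k : Stk) (q : Code A) : Code A :=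
  .pop (.inl (some k)) (fun v s => ({ v.1 with b := s }, v.2)) q

/-- Pop a bit from the stack `k` into the register `b'`. -/
def popB' (k : Stk) (q : Code A) : Code A :=
  .pop (.inl (some k)) (fun v s => ({ v.1 with b' := s }, v.2)) q

/-- Push a bit, computed from the registers, on the stack `k`. -/
def push (k : Stk) (f : Reg → Bool) (q : Code A) : Code A :=
  .push (.inl (some k)) (fun v => f v.1) q

/-- Push a symbol on the input stack of the subroutine `i`. -/
def ask (i : Bool) (f : Reg → Option Bool) (q : Code A) : Code A :=
  .push (.inr ⟨i, (A i).tm.k₀⟩) (fun v => (A i).inputAlphabet.symm (f v.1)) q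

/-- Pop the answer of the subroutine `i` into the register `b`. -/
def answer (i : Bool) (q : Code A) : Code A :=
  .pop (.inr ⟨i, (A i).tm.k₁⟩)
    (fun v s => ({ v.1 with b := s.map (A i).outputAlphabet }, v.2)) q

/-- Branch on the registers. -/
def branch (f : Reg → Bool) (q₁ q₂ : Code A) : Code A := .branch (fun v => f v.1) q₁ q₂

/-- The bit that was popped from the input stack. -/
def Reg.bitA (v : Reg) : Bool := v.a.join.getD false

/-- The bit that was popped from a stack of words. -/
def Reg.bitB (v : Reg) : Bool := v.b.getD false

/-- Write the separator that follows the last word of either query, then copy `z`. -/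
def startCopy : Code A := ask true (fun _ => none) (ask false (fun _ => none) (next .copyZ))

/-- Pop a symbol from the stack `k`, and record in the register `more` whether there was one. -/
def drain (k : Idx A) (q : Code A) : Code A :=
  .pop k (fun v s => ({ v.1 with more := v.1.more || s.isSome }, v.2)) q

/-- The code of the calling machine, for the input `x#y#u#`.

* `readX` and `readY` put the reversals of `x` and `y` on stacks. At the start `x` is taken both for
  the current element and for the next one, so that the first round tests whether `x ∈ P`.
* `copyZ` and `copyR` start a round: they write the next element `z` and the pair of the current
  element and `z` on the input stacks of the subroutines, and `z` becomes the current element.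
* `retMem` and `retInc` evaluate the answers. The register `par` is flipped in every round, so that
  it is `true` after the round for `x`, and then tells the parity of the number of steps.
* `head` tests whether there is a further block, and `block` reads it. The register `flag` records
  whether it differs from the current element. If not, the answer is "no"; this includes the case
  of blocks of length zero, on which the machine would otherwise run forever.
* `revC` and `compare` compare the last element with `y`.
* `clean` empties all stacks and writes the answer, which is in `flag`. -/
def code (t : Bool) : Lab → Code A
  | .readX => popInput (branch (fun v => v.a.join.isSome)
      (push .z Reg.bitA (push .r Reg.bitA (next .readX))) (next .readY))
  | .readY => popInput (branch (fun v => v.a.join.isSome)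
      (push .y Reg.bitA (next .readY)) startCopy)
  | .copyZ => popB .z (branch (fun v => v.b.isSome)
      (ask true Reg.b (ask false Reg.b (push .c Reg.bitB (next .copyZ))))
      (ask false (fun _ => none) (next .copyR)))
  | .copyR => popB .r (branch (fun v => v.b.isSome)
      (ask false Reg.b (next .copyR)) (call true))
  | .retMem => answer true (branch Reg.bitB (call false) reject)
  | .retInc => answer false (branch Reg.bitB
      (jump (fun v => !v.par) (fun _ => false) (.inl .head)) reject)
  | .head => .peek (.inl none) (fun v s => ({ v.1 with a := s }, v.2))
      (branch (fun v => v.a.join.isSome) (next .block) (next .revC))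
  | .block => popB .c (branch (fun v => v.b.isSome)
      (push .r Reg.bitB (popInput (branch (fun v => v.a.join.isSome)
        (push .z Reg.bitA
          (jump Reg.par (fun v => v.flag || v.bitA != v.bitB) (.inl .block)))
        reject)))
      (branch Reg.flag startCopy reject))
  | .revC => popB .c (branch (fun v => v.b.isSome)
      (push .z Reg.bitB (next .revC)) (next .compare))
  | .compare => popB .z (popB' .y (branch (fun v => v.b == v.b')
      (branch (fun v => v.b.isSome) (next .compare)
        (jump Reg.par (fun v => v.par == t) (.inl .clean)))
      reject))
  | .clean => drain (.inl none) (drain (.inl (some .y)) (drain (.inl (some .c))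
      (drain (.inl (some .r)) (drain (.inl (some .z)) (drain (.inr ⟨true, (A true).tm.k₀⟩)
      (drain (.inr ⟨false, (A false).tm.k₀⟩) (branch Reg.more (next .clean)
        (push .out Reg.flag (.load (fun v => ({ par := false, flag := false }, v.2)) .halt)))))))))

variable (A)

/-- The machine that decides `CodesChain t`, if `A true` decides membership and `A false` decides
the order. -/
def machine (t : Bool) : FinTM2 where
  K := Idx A
  k₀ := .inl none
  k₁ := .inl (some .out)
  Γ := Alph A
  Λ := Label A
  main := .inl .readX
  σ := State A
  initialState := ({ par := false, flag := false }, fun i => (A i).tm.initialState)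
  Γk₀Fin := inferInstanceAs (Fintype (Option Bool))
  m
    | .inl l => code t l
    | .inr l => embed l.1 ((A l.1).tm.m l.2)

/-- The contents of the stacks between two calls: those of the calling machine, and `m` and `n` on
the input stacks of the subroutines `true` and `false`, whose other stacks are empty. -/
structure Store where
  inp : List (Option Bool)
  y : Word
  c : Word
  r : Word
  z : Word
  out : Word := []
  m : List (Option Bool)
  n : List (Option Bool)

namespace Store

/-- The input of the subroutine `i`. -/
def query (s : Store) (i : Bool) : List (Option Bool) := bif i then s.m else s.n

/-- All stacks, with contents `sub` for those of the subroutines. -/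
def stkWith (s : Store) (sub : ∀ i k, List ((A i).tm.Γ k)) : ∀ k, List (Alph A k)
  | .inl none => s.inp
  | .inl (some .y) => s.y
  | .inl (some .c) => s.c
  | .inl (some .r) => s.r
  | .inl (some .z) => s.z
  | .inl (some .out) => s.out
  | .inr k => sub k.1 k.2

/-- The stacks of the subroutines between two calls. -/
def sub (s : Store) (i : Bool) : ∀ k, List ((A i).tm.Γ k) :=
  Function.update (fun _ => []) (A i).tm.k₀ ((s.query i).map (A i).inputAlphabet.symm)

/-- All stacks between two calls. -/
def stk (s : Store) : ∀ k, List (Alph A k) := stkWith A s (sub A s)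

variable {A} (s : Store)

theorem update_stkWith (sub : ∀ i k, List ((A i).tm.Γ k)) (i : Bool) (k : (A i).tm.K)
    (l : List ((A i).tm.Γ k)) :
    Function.update (stkWith A s sub) (.inr ⟨i, k⟩) l =
      stkWith A s (Function.update sub i (Function.update (sub i) k l)) := by
  ext1 k'
  rcases k' with k' | ⟨i', k'⟩
  · rcases k' with (_ | _ | _ | _ | _ | _) <;> rfl
  · by_cases hi : i' = i
    · subst hi
      by_cases hk : k' = k
      · subst hk
        simp [stkWith]
      · have : (Sum.inr ⟨i', k'⟩ : Idx A) ≠ .inr ⟨i', k⟩ := by simpa using hk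
        rw [Function.update_of_ne this]
        simp [hk, stkWith]
    · have : (Sum.inr ⟨i', k'⟩ : Idx A) ≠ .inr ⟨i, k⟩ := by
        intro h
        simp only [Sum.inr.injEq, Sigma.mk.injEq] at h
        exact hi h.1
      rw [Function.update_of_ne this]
      simp [hi, stkWith]

@[simp] theorem stk_inp : stk A s (.inl none) = s.inp := rfl
@[simp] theorem stk_y : stk A s (.inl (some .y)) = s.y := rfl
@[simp] theorem stk_c : stk A s (.inl (some .c)) = s.c := rfl
@[simp] theorem stk_r : stk A s (.inl (some .r)) = s.r := rfl
@[simp] theorem stk_z : stk A s (.inl (some .z)) = s.z := rfl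
@[simp] theorem stk_out : stk A s (.inl (some .out)) = s.out := rfl

@[simp] theorem update_inp (l : List (Option Bool)) :
    Function.update (stk A s) (.inl none) l = stk A { s with inp := l } := by
  ext1 k; rcases k with (_ | _ | _ | _ | _ | _) | k <;> rfl
@[simp] theorem update_y (l : Word) :
    Function.update (stk A s) (.inl (some .y)) l = stk A { s with y := l } := by
  ext1 k; rcases k with (_ | _ | _ | _ | _ | _) | k <;> rfl
@[simp] theorem update_c (l : Word) :
    Function.update (stk A s) (.inl (some .c)) l = stk A { s with c := l } := by
  ext1 k; rcases k with (_ | _ | _ | _ | _ | _) | k <;> rfl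
@[simp] theorem update_r (l : Word) :
    Function.update (stk A s) (.inl (some .r)) l = stk A { s with r := l } := by
  ext1 k; rcases k with (_ | _ | _ | _ | _ | _) | k <;> rfl
@[simp] theorem update_z (l : Word) :
    Function.update (stk A s) (.inl (some .z)) l = stk A { s with z := l } := by
  ext1 k; rcases k with (_ | _ | _ | _ | _ | _) | k <;> rfl
@[simp] theorem update_out (l : Word) :
    Function.update (stk A s) (.inl (some .out)) l = stk A { s with out := l } := by
  ext1 k; rcases k with (_ | _ | _ | _ | _ | _) | k <;> rfl

theorem stk_input (i : Bool) :
    stk A s (.inr ⟨i, (A i).tm.k₀⟩) = (s.query i).map (A i).inputAlphabet.symm := by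
  simp [stk, stkWith, sub]

theorem update_sub {s s' : Store} {i : Bool} {l : List (Option Bool)} (hi : s'.query i = l)
    (hi' : s'.query (!i) = s.query (!i)) :
    Function.update (sub A s) i (Function.update (sub A s i) (A i).tm.k₀
      (l.map (A i).inputAlphabet.symm)) = sub A s' := by
  subst hi
  funext i'
  by_cases h : i' = i
  · subst h
    simp [sub]
  · obtain rfl : i' = !i := by revert h; cases i <;> cases i' <;> simp
    simp [sub, hi']

theorem cons_m (b : Option Bool) :
    Function.update (stk A s) (.inr ⟨true, (A true).tm.k₀⟩)
      ((A true).inputAlphabet.symm b :: stk A s (.inr ⟨true, (A true).tm.k₀⟩)) =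
      stk A { s with m := b :: s.m } := by
  rw [stk_input]
  exact (update_stkWith ..).trans
    (congrArg (stkWith A s) (update_sub (s' := { s with m := b :: s.m }) rfl rfl))

theorem cons_n (b : Option Bool) :
    Function.update (stk A s) (.inr ⟨false, (A false).tm.k₀⟩)
      ((A false).inputAlphabet.symm b :: stk A s (.inr ⟨false, (A false).tm.k₀⟩)) =
      stk A { s with n := b :: s.n } := by
  rw [stk_input]
  exact (update_stkWith ..).trans
    (congrArg (stkWith A s) (update_sub (s' := { s with n := b :: s.n }) rfl rfl))

theorem tail_m :
    Function.update (stk A s) (.inr ⟨true, (A true).tm.k₀⟩)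
      (stk A s (.inr ⟨true, (A true).tm.k₀⟩)).tail = stk A { s with m := s.m.tail } := by
  rw [stk_input, ← List.map_tail]
  exact (update_stkWith ..).trans
    (congrArg (stkWith A s) (update_sub (s' := { s with m := s.m.tail }) rfl rfl))

theorem tail_n :
    Function.update (stk A s) (.inr ⟨false, (A false).tm.k₀⟩)
      (stk A s (.inr ⟨false, (A false).tm.k₀⟩)).tail = stk A { s with n := s.n.tail } := by
  rw [stk_input, ← List.map_tail]
  exact (update_stkWith ..).trans
    (congrArg (stkWith A s) (update_sub (s' := { s with n := s.n.tail }) rfl rfl))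

theorem isSome_head_m :
    (stk A s (.inr ⟨true, (A true).tm.k₀⟩)).head?.isSome = s.m.head?.isSome := by
  rw [stk_input]
  simp [query]

theorem isSome_head_n :
    (stk A s (.inr ⟨false, (A false).tm.k₀⟩)).head?.isSome = s.n.head?.isSome := by
  rw [stk_input]
  simp [query]

/-- The contents of the stacks when the subroutine `i` has returned the answer `a`. -/
def stkAnswer (i a : Bool) : ∀ k, List (Alph A k) :=
  stkWith A s (Function.update (sub A s) i
    (Function.update (fun _ => []) (A i).tm.k₁ [(A i).outputAlphabet.symm a]))

theorem stkAnswer_output (i a : Bool) :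
    stkAnswer (A := A) s i a (.inr ⟨i, (A i).tm.k₁⟩) = [(A i).outputAlphabet.symm a] := by
  simp [stkAnswer, stkWith]

theorem update_stkAnswer (s s' : Store) (i a : Bool) (hi : s'.query i = [])
    (hi' : s'.query (!i) = s.query (!i)) (hs : ∀ sub, stkWith A s sub = stkWith A s' sub) :
    Function.update (stkAnswer (A := A) s i a) (.inr ⟨i, (A i).tm.k₁⟩) [] = stk A s' := by
  rw [stkAnswer, update_stkWith, hs, stk]
  congr 1
  funext i'
  by_cases h : i' = i
  · subst h
    simp [sub, hi]
  · obtain rfl : i' = !i := by revert h; cases i <;> cases i' <;> simp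
    simp [sub, hi']

theorem update_stkAnswer_true (a : Bool) :
    Function.update (stkAnswer (A := A) s true a) (.inr ⟨true, (A true).tm.k₁⟩) [] =
      stk A { s with m := [] } :=
  update_stkAnswer _ _ _ _ rfl rfl fun _ => rfl

theorem update_stkAnswer_false (a : Bool) :
    Function.update (stkAnswer (A := A) s false a) (.inr ⟨false, (A false).tm.k₁⟩) [] =
      stk A { s with n := [] } :=
  update_stkAnswer _ _ _ _ rfl rfl fun _ => rfl

end Store

variable {A}

section stepAux

variable (q : Code A) (v : State A) (s : Store)

@[simp] theorem stepAux_ask_true (f : Reg → Option Bool) :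
    TM2.stepAux (ask true f q) v (s.stk A) =
      TM2.stepAux q v (Store.stk A { s with m := f v.1 :: s.m }) :=
  congrArg (TM2.stepAux q v) (s.cons_m _)

@[simp] theorem stepAux_ask_false (f : Reg → Option Bool) :
    TM2.stepAux (ask false f q) v (s.stk A) =
      TM2.stepAux q v (Store.stk A { s with n := f v.1 :: s.n }) :=
  congrArg (TM2.stepAux q v) (s.cons_n _)

@[simp] theorem stepAux_drain_true :
    TM2.stepAux (drain (.inr ⟨true, (A true).tm.k₀⟩) q) v (s.stk A) =
      TM2.stepAux q ({ v.1 with more := v.1.more || s.m.head?.isSome }, v.2)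
        (Store.stk A { s with m := s.m.tail }) := by
  rw [← Store.tail_m, ← Store.isSome_head_m (A := A)]
  rfl

@[simp] theorem stepAux_drain_false :
    TM2.stepAux (drain (.inr ⟨false, (A false).tm.k₀⟩) q) v (s.stk A) =
      TM2.stepAux q ({ v.1 with more := v.1.more || s.n.head?.isSome }, v.2)
        (Store.stk A { s with n := s.n.tail }) := by
  rw [← Store.tail_n, ← Store.isSome_head_n (A := A)]
  rfl

theorem stepAux_drain (k : Stk) :
    TM2.stepAux (drain (.inl (some k)) q) v (s.stk A) =
      TM2.stepAux q ({ v.1 with more := v.1.more || (s.stk A (.inl (some k))).head?.isSome }, v.2)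
        (Function.update (s.stk A) (.inl (some k)) (s.stk A (.inl (some k))).tail) :=
  rfl

theorem stepAux_drain_inp :
    TM2.stepAux (drain (.inl none) q) v (s.stk A) =
      TM2.stepAux q ({ v.1 with more := v.1.more || s.inp.head?.isSome }, v.2)
        (Store.stk A { s with inp := s.inp.tail }) :=
  congrArg (TM2.stepAux q ({ v.1 with more := v.1.more || s.inp.head?.isSome }, v.2))
    (s.update_inp _)

theorem stepAux_answer (i a : Bool) :
    TM2.stepAux (answer i q) v (s.stkAnswer i a) = TM2.stepAux q ({ v.1 with b := some a }, v.2)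
      (Function.update (s.stkAnswer i a) (.inr ⟨i, (A i).tm.k₁⟩) []) := by
  have h := s.stkAnswer_output (A := A) i a
  have h' : ((s.stkAnswer i a (.inr ⟨i, (A i).tm.k₁⟩)).head?.map (A i).outputAlphabet) =
      some a := by
    rw [h]
    exact congrArg some ((A i).outputAlphabet.apply_symm_apply a)
  rw [← h']
  have h'' : (s.stkAnswer i a (.inr ⟨i, (A i).tm.k₁⟩)).tail = [] := by
    rw [h]
    rfl
  rw [← h'']
  rfl

@[simp] theorem stepAux_answer_true (a : Bool) :
    TM2.stepAux (answer true q) v (s.stkAnswer true a) =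
      TM2.stepAux q ({ v.1 with b := some a }, v.2) (Store.stk A { s with m := [] }) := by
  rw [stepAux_answer, Store.update_stkAnswer_true]

@[simp] theorem stepAux_answer_false (a : Bool) :
    TM2.stepAux (answer false q) v (s.stkAnswer false a) =
      TM2.stepAux q ({ v.1 with b := some a }, v.2) (Store.stk A { s with n := [] }) := by
  rw [stepAux_answer, Store.update_stkAnswer_false]

end stepAux

/-- A step of a subroutine is a step of the whole machine. -/
theorem stepAux_embed (i : Bool) (q : TM2.Stmt (A i).tm.Γ (A i).tm.Λ (A i).tm.σ) (v : State A)
    (s : Store) (sub : ∀ i k, List ((A i).tm.Γ k)) :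
    TM2.stepAux (embed i q) v (s.stkWith A sub) =
      let c := TM2.stepAux q (v.2 i) (sub i)
      ⟨some (c.l.elim (.inl (ret i)) fun l => .inr ⟨i, l⟩), (v.1, Function.update v.2 i c.var),
        s.stkWith A (Function.update sub i c.stk)⟩ := by
  induction q generalizing v sub with
  | push k f q ih =>
    simp only [embed, TM2.stepAux, Store.update_stkWith, ih, Function.update_self,
      Function.update_idem]
    rfl
  | peek k f q ih =>
    simp only [embed, TM2.stepAux, ih, Function.update_self, Function.update_idem]
    rfl
  | pop k f q ih =>
    simp only [embed, TM2.stepAux, Store.update_stkWith, ih, Function.update_self,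
      Function.update_idem]
    rfl
  | load f q ih => simp [embed, ih]
  | branch f q₁ q₂ ih₁ ih₂ =>
    cases h : f (v.2 i) <;> simp [embed, ih₁, ih₂, h]
  | goto f => simp [embed]
  | halt => simp [embed]

/-! ### Running the machine -/

theorem initList_stk (tm : FinTM2) (l : List (tm.Γ tm.k₀)) :
    (initList tm l).stk = Function.update (fun _ => []) tm.k₀ l := by
  funext k
  by_cases h : k = tm.k₀
  · subst h
    simp [initList]
  · simp [initList, h]

theorem haltList_stk (tm : FinTM2) (l : List (tm.Γ tm.k₁)) :
    (haltList tm l).stk = Function.update (fun _ => []) tm.k₁ l := by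
  funext k
  by_cases h : k = tm.k₁
  · subst h
    simp [haltList]
  · simp [haltList, h]

variable (A : Bool → TM2ComputableAux (Option Bool) Bool)

/-- The configuration of the machine at the label `l` of its calling part. -/
def cfg (l : Lab) (par flag : Bool) (s : Store) : TM2.Cfg (Alph A) (Label A) (State A) :=
  ⟨some (.inl l), ({ par, flag }, fun i => (A i).tm.initialState), s.stk A⟩

/-- The configuration of the machine when it calls the subroutine `i`. -/
def callCfg (i : Bool) (par flag : Bool) (s : Store) : TM2.Cfg (Alph A) (Label A) (State A) :=
  ⟨some (.inr ⟨i, (A i).tm.main⟩), ({ par, flag }, fun i => (A i).tm.initialState), s.stk A⟩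

variable {A}

/-- From the configuration `c`, the machine halts with output `b` after at most `T` steps. -/
def Decides (t : Bool) (T : ℕ) (c : TM2.Cfg (Alph A) (Label A) (State A)) (b : Bool) : Prop :=
  Nonempty (StateTransition.EvalsToInTime (machine A t).step c
    (some (haltList (machine A t) [b])) T)

variable {t : Bool} {T : ℕ} {b par flag : Bool} {s : Store}

theorem Decides.mono {T' : ℕ} {c : TM2.Cfg (Alph A) (Label A) (State A)}
    (h : Decides t T c b) (hT : T ≤ T') : Decides t T' c b :=
  h.map fun h => { h with steps_le_m := h.steps_le_m.trans hT }

theorem Decides.of_step {c c' : TM2.Cfg (Alph A) (Label A) (State A)}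
    (hc : (machine A t).step c = some c') (h : Decides t T c' b) : Decides t (T + 1) c b :=
  h.map fun h => StateTransition.EvalsToInTime.trans _ 1 T c c' _ ⟨⟨1, hc⟩, le_rfl⟩ h

theorem Decides.of_stepAux_stk {l : Lab} {S : ∀ k, List (Alph A k)}
    {c : TM2.Cfg (Alph A) (Label A) (State A)} (h : Decides t T c b)
    (hc : TM2.stepAux (code t l) ({ par, flag }, fun i => (A i).tm.initialState) S = c) :
    Decides t (T + 1) ⟨some (.inl l), ({ par, flag }, fun i => (A i).tm.initialState), S⟩ b :=
  h.of_step (congrArg some hc)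

theorem Decides.of_stepAux {l : Lab} {c : TM2.Cfg (Alph A) (Label A) (State A)}
    (h : Decides t T c b)
    (hc : TM2.stepAux (code t l) ({ par, flag }, fun i => (A i).tm.initialState) (s.stk A) = c) :
    Decides t (T + 1) (cfg A l par flag s) b :=
  h.of_stepAux_stk hc

/-- A run of a subroutine is a run of the machine. -/
theorem Decides.of_iterate_embed {i : Bool} {n : ℕ} {v : Reg} {c c' : (A i).tm.Cfg} {f}
    {sub : ∀ i k, List ((A i).tm.Γ k)}
    (hc : (flip bind (A i).tm.step)^[n] (some c) = some c')
    (h : Decides t T ⟨some (c'.l.elim (.inl (ret i)) fun l => .inr ⟨i, l⟩),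
      (v, Function.update f i c'.var), s.stkWith A (Function.update sub i c'.stk)⟩ b) :
    Decides t (T + n) ⟨some (c.l.elim (.inl (ret i)) fun l => .inr ⟨i, l⟩),
      (v, Function.update f i c.var), s.stkWith A (Function.update sub i c.stk)⟩ b := by
  induction n generalizing c with
  | zero =>
    cases hc
    exact h
  | succ n ih =>
    rw [Function.iterate_succ_apply] at hc
    obtain ⟨l, w, S⟩ := c
    cases l with
    | none =>
      have h0 : (flip bind (A i).tm.step)^[n] none = none :=
        Function.iterate_fixed (by rfl) n
      have h1 : flip bind (A i).tm.step (some ⟨none, w, S⟩) = none := rfl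
      rw [h1, h0] at hc
      cases hc
    | some l =>
      refine Decides.of_step ?_ (ih hc)
      refine congrArg some ((stepAux_embed i ((A i).tm.m l) _ _ _).trans ?_)
      simp only [Function.update_self, Function.update_idem]

theorem decides_callCfg {i a : Bool} {S : ℕ}
    (hrun : Nonempty (TM2OutputsInTime (A i).tm ((s.query i).map (A i).inputAlphabet.invFun)
      (some ((Computability.encodeBool a).map (A i).outputAlphabet.invFun)) S))
    (h : Decides t T ⟨some (.inl (ret i)), ({ par, flag }, fun i => (A i).tm.initialState),
      s.stkAnswer i a⟩ b) :
    Decides t (T + S) (callCfg A i par flag s) b := by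
  obtain ⟨⟨n, hn⟩, hle⟩ := hrun
  refine Decides.mono (T := T + n) ?_ (Nat.add_le_add_left hle T)
  have := Decides.of_iterate_embed (t := t) (T := T) (b := b) (s := s) (v := { par, flag })
    (f := fun i => (A i).tm.initialState) (sub := Store.sub A s) hn
  rw [haltList_stk, initList_stk] at this
  simp only [haltList, initList, Function.update_eq_self] at this
  rw [show Function.update (fun _ => []) (A i).tm.k₀
    ((s.query i).map (A i).inputAlphabet.invFun) = Store.sub A s i from rfl,
    Function.update_eq_self] at this
  exact this h

/-- All stacks but the output stack are emptied, one symbol from each of them at a time. -/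
theorem decides_clean {M : ℕ} (hout : s.out = [])
    (hM : s.inp.length ≤ M ∧ s.y.length ≤ M ∧ s.c.length ≤ M ∧ s.r.length ≤ M ∧ s.z.length ≤ M ∧
      s.m.length ≤ M ∧ s.n.length ≤ M) :
    Decides t (M + 1) (cfg A .clean par flag s) flag := by
  obtain ⟨inp, y, c, r, z, out, m, n⟩ := s
  simp only at hout hM
  subst hout
  induction M generalizing inp y c r z m n with
  | zero =>
    simp only [Nat.le_zero, List.length_eq_zero_iff] at hM
    obtain ⟨rfl, rfl, rfl, rfl, rfl, rfl, rfl⟩ := hM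
    refine .of_stepAux (T := 0) (c := haltList (machine A t) [flag]) ⟨.refl _ _⟩ ?_
    refine (?_ : _ = (⟨none, ({ par := false, flag := false }, fun i => (A i).tm.initialState),
      Store.stk A ⟨[], [], [], [], [], [flag], [], []⟩⟩ :
        TM2.Cfg (Alph A) (Label A) (State A))).trans ?_
    · simp [code, stepAux_drain, stepAux_drain_inp, branch, push]
    · refine congrArg (TM2.Cfg.mk none _) ?_
      refine Eq.trans ?_ (haltList_stk (machine A t) [flag]).symm
      funext k
      rcases k with (_ | _ | _ | _ | _ | _) | ⟨i, k⟩
      all_goals try rfl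
      by_cases hk : k = (A i).tm.k₀
      · subst hk
        cases i <;> simp [Store.stk_input] <;> rfl
      · cases i <;> simp [Store.stk, Store.stkWith, Store.sub, hk] <;> rfl
  | succ M ih =>
    by_cases h0 : inp.head?.isSome || y.head?.isSome || c.head?.isSome || r.head?.isSome ||
      z.head?.isSome || m.head?.isSome || n.head?.isSome
    · refine .of_stepAux (ih inp.tail y.tail c.tail r.tail z.tail m.tail n.tail ?_) ?_
      · simp only [List.length_tail]
        omega
      · simp [code, stepAux_drain, stepAux_drain_inp, branch, next, jump, cfg, h0]
    · simp only [Bool.or_eq_true, List.isSome_head?, not_or, not_not, ne_eq] at h0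
      obtain ⟨⟨⟨⟨⟨⟨rfl, rfl⟩, rfl⟩, rfl⟩, rfl⟩, rfl⟩, rfl⟩ := h0
      exact (ih [] [] [] [] [] [] [] (by simp)).mono (by omega)

theorem decides_readX {x : Word} {rest : List (Option Bool)}
    (hinp : s.inp = x.map some ++ none :: rest)
    (h : Decides t T (cfg A .readY par flag
      { s with inp := rest, z := x.reverse ++ s.z, r := x.reverse ++ s.r }) b) :
    Decides t (T + x.length + 1) (cfg A .readX par flag s) b := by
  induction x generalizing s with
  | nil =>
    refine .of_stepAux h ?_
    simp [code, popInput, branch, next, jump, hinp, cfg]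
  | cons a x ih =>
    refine .of_stepAux (ih (s := { s with inp := _, z := a :: s.z, r := a :: s.r }) rfl ?_) ?_
    · simpa using h
    · simp [code, popInput, push, branch, next, jump, hinp, cfg, Reg.bitA]

theorem decides_readY {y : Word} {rest : List (Option Bool)}
    (hinp : s.inp = y.map some ++ none :: rest)
    (h : Decides t T (cfg A .copyZ par flag
      { s with inp := rest, y := y.reverse ++ s.y, m := none :: s.m, n := none :: s.n }) b) :
    Decides t (T + y.length + 1) (cfg A .readY par flag s) b := by
  induction y generalizing s with
  | nil =>
    refine .of_stepAux h ?_
    simp [code, popInput, branch, next, jump, hinp, cfg, startCopy]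
  | cons a x ih =>
    refine .of_stepAux (ih (s := { s with inp := _, y := a :: s.y }) rfl ?_) ?_
    · simpa using h
    · simp [code, popInput, push, branch, next, jump, hinp, cfg, Reg.bitA]

theorem decides_copyZ {z : Word} (hz : s.z = z)
    (h : Decides t T (cfg A .copyR par flag
      { s with
        z := []
        c := z.reverse ++ s.c
        m := z.reverse.map some ++ s.m
        n := none :: (z.reverse.map some ++ s.n) }) b) :
    Decides t (T + z.length + 1) (cfg A .copyZ par flag s) b := by
  induction z generalizing s with
  | nil =>
    refine .of_stepAux h ?_
    simp [code, popB, branch, next, jump, cfg, hz]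
  | cons a z ih =>
    refine .of_stepAux (ih (s := { s with
      z := _, c := a :: s.c, m := some a :: s.m, n := some a :: s.n }) rfl ?_) ?_
    · simpa using h
    · simp [code, popB, push, branch, next, jump, cfg, hz, Reg.bitB]

theorem decides_copyR {r : Word} (hr : s.r = r)
    (h : Decides t T (callCfg A true par flag
      { s with r := [], n := r.reverse.map some ++ s.n }) b) :
    Decides t (T + r.length + 1) (cfg A .copyR par flag s) b := by
  induction r generalizing s with
  | nil =>
    refine .of_stepAux h ?_
    simp [code, popB, branch, call, jump, callCfg, hr]
  | cons a r ih =>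
    refine .of_stepAux (ih (s := { s with r := _, n := some a :: s.n }) rfl ?_) ?_
    · simpa using h
    · simp [code, popB, branch, next, jump, cfg, hr]

/-- A query to the membership subroutine. -/
theorem decides_call_true {a : Bool} {S : ℕ}
    (hrun : Nonempty (TM2OutputsInTime (A true).tm (s.m.map (A true).inputAlphabet.invFun)
      (some ((Computability.encodeBool a).map (A true).outputAlphabet.invFun)) S))
    (htrue : a = true → Decides t T (callCfg A false par flag { s with m := [] }) b)
    (hfalse : a = false → Decides t T (cfg A .clean par false { s with m := [] }) b) :
    Decides t (T + 1 + S) (callCfg A true par flag s) b := by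
  refine decides_callCfg hrun ?_
  cases a with
  | true =>
    refine .of_stepAux_stk (htrue rfl) ?_
    simp [ret, code, branch, call, jump, callCfg, Reg.bitB]
  | false =>
    refine .of_stepAux_stk (hfalse rfl) ?_
    simp [ret, code, branch, reject, jump, cfg, Reg.bitB]

/-- A query to the subroutine for the order. -/
theorem decides_call_false {a : Bool} {S : ℕ}
    (hrun : Nonempty (TM2OutputsInTime (A false).tm (s.n.map (A false).inputAlphabet.invFun)
      (some ((Computability.encodeBool a).map (A false).outputAlphabet.invFun)) S))
    (htrue : a = true → Decides t T (cfg A .head (!par) false { s with n := [] }) b)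
    (hfalse : a = false → Decides t T (cfg A .clean par false { s with n := [] }) b) :
    Decides t (T + 1 + S) (callCfg A false par flag s) b := by
  refine decides_callCfg hrun ?_
  cases a with
  | true =>
    refine .of_stepAux_stk (htrue rfl) ?_
    simp [ret, code, branch, jump, cfg, Reg.bitB]
  | false =>
    refine .of_stepAux_stk (hfalse rfl) ?_
    simp [ret, code, branch, reject, jump, cfg, Reg.bitB]

theorem decides_head_cons {a : Bool} {rest : List (Option Bool)}
    (hinp : s.inp = some a :: rest) (h : Decides t T (cfg A .block par flag s) b) :
    Decides t (T + 1) (cfg A .head par flag s) b := by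
  refine .of_stepAux h ?_
  simp [code, branch, next, jump, cfg, hinp]

theorem decides_head_nil {rest : List (Option Bool)}
    (hinp : s.inp = none :: rest) (h : Decides t T (cfg A .revC par flag s) b) :
    Decides t (T + 1) (cfg A .head par flag s) b := by
  refine .of_stepAux h ?_
  simp [code, branch, next, jump, cfg, hinp]

theorem decides_revC {c : Word} (hc : s.c = c)
    (h : Decides t T (cfg A .compare par flag { s with c := [], z := c.reverse ++ s.z }) b) :
    Decides t (T + c.length + 1) (cfg A .revC par flag s) b := by
  induction c generalizing s with
  | nil =>
    refine .of_stepAux h ?_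
    simp [code, popB, branch, next, jump, cfg, hc]
  | cons a c ih =>
    refine .of_stepAux (ih (s := { s with c := _, z := a :: s.z }) rfl ?_) ?_
    · simpa using h
    · simp [code, popB, push, branch, next, jump, cfg, hc, Reg.bitB]

theorem decides_compare {M : ℕ} {y z : Word} (hz : s.z = z) (hy : s.y = y) (hout : s.out = [])
    (hM : s.inp.length ≤ M ∧ s.y.length ≤ M ∧ s.c.length ≤ M ∧ s.r.length ≤ M ∧ s.z.length ≤ M ∧
      s.m.length ≤ M ∧ s.n.length ≤ M) :
    Decides t (M + 1 + z.length + 1) (cfg A .compare par flag s)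
      (decide (z = y) && par == t) := by
  have hclean : ∀ {z y : Word} {flag'}, z.length ≤ M → y.length ≤ M →
      Decides t (M + 1) (cfg A .clean par flag' { s with z, y }) flag' := fun hz hy =>
    decides_clean hout (by simp only; omega)
  induction z generalizing s y with
  | nil =>
    cases y with
    | nil =>
      refine .of_stepAux (hclean (z := []) (y := []) (by simp) (by simp)) ?_
      simp [code, popB, popB', branch, jump, cfg, hz, hy]
    | cons d y =>
      refine .of_stepAux (hclean (z := []) (y := y) (by simp) ?_) ?_
      · rw [hy, List.length_cons] at hM
        omega
      · simp [code, popB, popB', branch, reject, jump, cfg, hz, hy]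
  | cons a z ih =>
    rw [hz, hy] at hM
    simp only [List.length_cons] at hM
    cases y with
    | nil =>
      refine (Decides.of_stepAux (hclean (z := z) (y := []) (by omega) (by simp)) ?_).mono
        (by omega)
      simp [code, popB, popB', branch, reject, jump, cfg, hz, hy]
    | cons d y =>
      simp only [List.length_cons] at hM
      by_cases h : a = d
      · subst h
        refine (Decides.of_stepAux (c := cfg A .compare par flag { s with z := z, y := y })
          (b := decide (a :: z = a :: y) && par == t) (T := M + 1 + z.length + 1) ?_ ?_).mono
          (by simp only [List.length_cons]; omega)
        · simpa using ih (s := { s with z := z, y := y }) rfl rfl hout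
            (by simp only; omega) hclean
        · simp [code, popB, popB', branch, next, jump, cfg, hz, hy]
      · refine (Decides.of_stepAux (c := cfg A .clean par false { s with z := z, y := y })
          ?_ ?_).mono (T := M + 1 + 1) (by omega)
        · simpa [h] using hclean (z := z) (y := y) (flag' := false) (by omega) (by omega)
        · simp [code, popB, popB', branch, reject, jump, cfg, hz, hy, beq_eq_false_iff_ne.2 h]

/-- The input ends within a block: the answer is "no". -/
theorem decides_block_short {M : ℕ} {u c : Word} {rest : List (Option Bool)}
    (hc : s.c = c) (hinp : s.inp = u.map some ++ none :: rest) (hlen : u.length < c.length)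
    (hout : s.out = [])
    (hM : s.inp.length ≤ M ∧ s.y.length ≤ M ∧ s.c.length + s.r.length ≤ M ∧
      s.c.length + s.z.length ≤ M ∧ s.m.length ≤ M ∧ s.n.length ≤ M) :
    Decides t (M + 1 + u.length + 1) (cfg A .block par flag s) false := by
  induction u generalizing s c flag with
  | nil =>
    cases c with
    | nil => simp at hlen
    | cons d c =>
      rw [hc, hinp] at hM
      simp only [List.length_cons, List.map_nil, List.nil_append] at hM
      refine .of_stepAux (decides_clean (M := M) (par := par)
        (s := { s with inp := rest, c := c, r := d :: s.r }) hout ?_) ?_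
      · simp only [List.length_cons]
        omega
      · simp [code, popB, popInput, push, branch, reject, jump, cfg, hc, hinp, Reg.bitB]
  | cons a u ih =>
    cases c with
    | nil => simp at hlen
    | cons d c =>
      rw [hc, hinp] at hM
      simp only [List.length_cons, List.map_cons, List.cons_append] at hM hlen
      refine .of_stepAux (ih (c := c) (flag := flag || a != d)
        (s := { s with inp := _, c := c, r := d :: s.r, z := a :: s.z })
        rfl rfl (by omega) hout ?_) ?_
      · simp only [List.length_cons]
        omega
      · simp [code, popB, popInput, push, branch, jump, cfg, hc, hinp, Reg.bitA, Reg.bitB]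

/-- A block `u` is read; a round follows unless it repeats the current element `c`. -/
theorem decides_block {u c : Word} {rest : List (Option Bool)}
    (hc : s.c = c) (hinp : s.inp = u.map some ++ rest) (hlen : u.length = c.length)
    (htrue : (flag || u != c) = true → Decides t T (cfg A .copyZ par true
      { s with
        inp := rest
        c := []
        r := c.reverse ++ s.r
        z := u.reverse ++ s.z
        m := none :: s.m
        n := none :: s.n }) b)
    (hfalse : (flag || u != c) = false → Decides t T (cfg A .clean par false
      { s with inp := rest, c := [], r := c.reverse ++ s.r, z := u.reverse ++ s.z }) b) :
    Decides t (T + u.length + 1) (cfg A .block par flag s) b := by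
  induction u generalizing s c flag with
  | nil =>
    obtain rfl : c = [] := by simpa using hlen.symm
    obtain rfl : s.inp = rest := hinp
    cases flag with
    | true =>
      refine .of_stepAux (htrue rfl) ?_
      simp [code, popB, branch, next, jump, cfg, hc, startCopy]
    | false =>
      refine .of_stepAux (hfalse rfl) ?_
      simp [code, popB, branch, reject, jump, cfg, hc]
  | cons a u ih =>
    cases c with
    | nil => simp at hlen
    | cons d c =>
      simp only [List.length_cons, Nat.add_right_cancel_iff] at hlen
      have hflag : (flag || (a :: u) != (d :: c)) = ((flag || a != d) || u != c) := by
        simp [bne, Bool.or_assoc]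
      rw [hflag] at htrue hfalse
      refine .of_stepAux (ih (c := c) (flag := flag || a != d)
        (s := { s with inp := _, c := c, r := d :: s.r, z := a :: s.z })
        rfl rfl hlen ?_ ?_) ?_
      · simpa using htrue
      · simpa using hfalse
      · simp [code, popB, popInput, push, branch, jump, cfg, hc, hinp, Reg.bitA, Reg.bitB]

end ChainMachine

/-! ### Correctness and running time -/

@[simp] theorem encodeWords_nil : encodeWords [] = [] := rfl

@[simp] theorem encodeWords_cons (w : Word) (ws : List Word) :
    encodeWords (w :: ws) = w.map some ++ none :: encodeWords ws := by
  simp [encodeWords]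

theorem _root_.Polynomial.eval_mono_nat (p : Polynomial ℕ) : Monotone fun n => p.eval n := by
  intro m n h
  simp only [Polynomial.eval_eq_sum]
  exact Finset.sum_le_sum fun i _ => Nat.mul_le_mul_left _ (Nat.pow_le_pow_left h i)

namespace ChainMachine

variable {A : Bool → TM2ComputableAux (Option Bool) Bool} {P : WordPoset}
  {t : Bool} {T : ℕ} {b par flag : Bool} {s : Store}

/-- The machine of `M` answers `a` on the input `ws`, after at most `T` steps. -/
def Answers (M : TM2ComputableAux (Option Bool) Bool) (ws : List Word) (a : Bool) (T : ℕ) : Prop :=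
  Nonempty (TM2OutputsInTime M.tm ((encodeWords ws).map M.inputAlphabet.invFun)
    (some ((Computability.encodeBool a).map M.outputAlphabet.invFun)) T)

theorem Answers.mono {M : TM2ComputableAux (Option Bool) Bool} {ws : List Word} {a : Bool}
    {T T' : ℕ} (h : Answers M ws a T) (hT : T ≤ T') : Answers M ws a T' :=
  h.map fun h => { h with steps_le_m := h.steps_le_m.trans hT }

open Classical in
/-- One round of the machine: test whether `z` belongs to `P` and lies above `w`. The first test
makes sure that the promise of the second one is kept. -/
theorem decides_copyZ_of_le {M S₁ S₂ : ℕ} {w z y : Word} {inp : List (Option Bool)}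
    (hmem : Answers (A true) [z] (decide (z ∈ P.carrier)) S₁)
    (hinc : z ∈ P.carrier → Answers (A false) [w, z] (decide (P.le w z)) S₂)
    (hMT : M + 1 ≤ T)
    (hM : inp.length ≤ M ∧ y.length ≤ M ∧ w.length + z.length + 2 ≤ M)
    (hle : P.le w z →
      Decides t T (cfg A .head (!par) false ⟨inp, y, z, [], [], [], [], []⟩) b)
    (hnle : ¬ P.le w z → b = false) :
    Decides t (T + 1 + S₂ + 1 + S₁ + w.length + 1 + z.length + 1)
      (cfg A .copyZ par flag ⟨inp, y, [], w.reverse, z.reverse, [], [none], [none]⟩) b := by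
  have hcall : z ∈ P.carrier → Decides t (T + 1 + S₂) (callCfg A false par flag
      ⟨inp, y, z, [], [], [], [], encodeWords [w, z]⟩) b := fun hz =>
    decides_call_false (hinc hz) (fun h => hle (of_decide_eq_true h)) fun h => by
      rw [hnle (of_decide_eq_false h)]
      refine (decides_clean (M := M) rfl ?_).mono hMT
      simp
      omega
  have hcall' : Decides t (T + 1 + S₂ + 1 + S₁) (callCfg A true par flag
      ⟨inp, y, z, [], [], [], encodeWords [z], encodeWords [w, z]⟩) b :=
    decides_call_true hmem (fun h => hcall (of_decide_eq_true h)) fun h => by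
      rw [hnle fun h' => of_decide_eq_false h (P.mem_right h')]
      refine (decides_clean (M := M) rfl ?_).mono (by omega)
      simp
      omega
  have h := decides_copyZ (flag := flag)
    (s := ⟨inp, y, [], w.reverse, z.reverse, [], [none], [none]⟩) rfl
    (decides_copyR (T := T + 1 + S₂ + 1 + S₁) rfl (by simpa using hcall'))
  simpa using h

open Classical in
/-- The main loop: from `cur`, the machine follows the chain coded by the rest `u` of the input.
Every round that passes shortens `u`, so that there are at most `u.length` of them. -/
theorem decides_head {N S : ℕ} {y : Word}
    (hmem : ∀ z : Word, z.length ≤ N → Answers (A true) [z] (decide (z ∈ P.carrier)) S)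
    (hinc : ∀ w ∈ P.carrier, ∀ z ∈ P.carrier, w.length = z.length → z.length ≤ N →
      Answers (A false) [w, z] (decide (P.le w z)) S) (hy : y.length ≤ N)
    {u cur : Word} (hu : u.length ≤ N) (hcur : cur.length ≤ N) (hmc : cur ∈ P.carrier) :
    Decides t ((u.length + 1) * (2 * S + 8 * N + 20))
      (cfg A .head par false ⟨u.map some ++ [none], y.reverse, cur, [], [], [], [], []⟩)
      (decide (P.CodesChain (par == t) cur y u)) := by
  induction hn : u.length using Nat.strong_induction_on generalizing u cur par with
  | _ n ih =>
  subst hn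
  by_cases hu0 : u = []
  · subst hu0
    refine ((decides_head_nil rfl (decides_revC rfl ?_)).mono
      (T := 2 * N + 2 + 1 + N + 1 + cur.length + 1 + 1) ?_)
    · have h := decides_compare (A := A) (t := t) (par := par) (flag := false) (M := 2 * N + 2)
        (s := ⟨[none], y.reverse, [], [], cur.reverse, [], [], []⟩) rfl rfl rfl
        (by simp; omega)
      have e : (decide (P.CodesChain (par == t) cur y []) : Bool) =
          (decide (cur.reverse = y.reverse) && par == t) := by
        rw [Bool.eq_iff_iff]
        simp [WordPoset.codesChain_nil_iff, hmc, and_comm]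
      rw [e]
      refine Decides.mono (T := 2 * N + 2 + 1 + cur.length + 1) ?_ (by omega)
      simpa using h
    · simp
      omega
  · have hiff := WordPoset.codesChain_iff_of_ne_nil (P := P) (p := par == t) (x := cur) (y := y) hu0
    obtain ⟨d, u', hdu⟩ := List.exists_cons_of_ne_nil hu0
    have hQ : 2 * S + 8 * N + 20 ≤ u.length * (2 * S + 8 * N + 20) :=
      Nat.le_mul_of_pos_left _ (List.length_pos_iff.2 hu0)
    rw [add_mul, one_mul]
    -- An incomplete block is rejected.
    rcases lt_or_ge u.length cur.length with hlt | hge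
    · have hno : ¬ P.CodesChain (par == t) cur y u := fun h => by
        have := P.length_eq (hiff.1 h).1
        rw [List.length_take] at this
        omega
      rw [decide_eq_false hno]
      refine (decides_head_cons (a := d) (congrArg (fun l => List.map some l ++ [none]) hdu)
        (decides_block_short (M := 2 * N + 2) (u := u) (rest := []) rfl rfl hlt rfl ?_)).mono ?_
      · simp
        omega
      · omega
    · have hlen : (u.take cur.length).length = cur.length := by simpa using hge
      have hinp : u.map some ++ [none] =
          (u.take cur.length).map some ++ ((u.drop cur.length).map some ++ [none]) := by
        rw [← List.append_assoc, ← List.map_append, List.take_append_drop]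
      generalize hz : u.take cur.length = z at *
      generalize hv : u.drop cur.length = v at *
      have huv : u.length = cur.length + v.length := by
        rw [← hv, List.length_drop]
        omega
      refine (decides_head_cons (a := d) (congrArg (fun l => List.map some l ++ [none]) hdu)
        (decides_block (u := z) (T := u.length * (2 * S + 8 * N + 20) + 2 * S + 2 * N + 4)
          (rest := v.map some ++ [none])
          rfl hinp hlen (fun h => ?_) fun h => ?_)).mono (by omega)
      · have hne : cur ≠ z := Ne.symm (by simpa using h)
        -- Words of length zero do not differ, so a round that passes shortens the input.
        have hpos : 0 < cur.length := by
          rw [List.length_pos_iff]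
          rintro rfl
          exact hne (List.length_eq_zero_iff.1 hlen).symm
        have hmul : (v.length + 1) * (2 * S + 8 * N + 20) ≤ u.length * (2 * S + 8 * N + 20) :=
          Nat.mul_le_mul_right _ (by omega)
        refine Decides.mono (T := u.length * (2 * S + 8 * N + 20) + 1 + S + 1 + S + cur.length +
          1 + z.length + 1) ?_ (by omega)
        · simp only [List.append_nil]
          refine decides_copyZ_of_le (T := u.length * (2 * S + 8 * N + 20)) (M := 2 * N + 2)
            (hmem z (by omega)) (fun hz => hinc cur hmc z hz hlen.symm (by omega)) (by omega) ?_
            (fun hle => ?_) (fun hle => ?_)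
          · simp
            omega
          · have := ih v.length (by omega) (u := v) (cur := z) (par := !par) (by omega) (by omega)
              (P.mem_right hle) rfl
            have e : P.CodesChain ((!par) == t) z y v ↔ P.CodesChain (par == t) cur y u := by
              have hp : ((!par) == t) = !(par == t) := by cases par <;> cases t <;> rfl
              rw [hiff, hp]
              simp [hle, hne]
            simp only [e] at this
            exact this.mono hmul
          · exact decide_eq_false fun h => hle (hiff.1 h).1
      · have hne : cur = z := Eq.symm (by simpa using h)
        have hno : ¬ P.CodesChain (par == t) cur y u := fun h => (hiff.1 h).2.1 hne
        rw [decide_eq_false hno]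
        refine (decides_clean (M := 2 * N + 2) rfl ?_).mono (by omega)
        simp
        omega

open Classical in
/-- The machine decides `CodesChain t`, in a number of steps that is polynomial in a bound `N` for
the lengths of the words and in a bound `S` for the running times of the subroutines. -/
theorem decides_readX_codesChain {N S : ℕ} {x y u : Word}
    (hmem : ∀ z : Word, z.length ≤ N → Answers (A true) [z] (decide (z ∈ P.carrier)) S)
    (hinc : ∀ w ∈ P.carrier, ∀ z ∈ P.carrier, w.length = z.length → z.length ≤ N →
      Answers (A false) [w, z] (decide (P.le w z)) S)
    (hx : x.length ≤ N) (hy : y.length ≤ N) (hu : u.length ≤ N) :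
    Decides t ((N + 3) * (2 * S + 8 * N + 20))
      (cfg A .readX false false ⟨encodeWords [x, y, u], [], [], [], [], [], [], []⟩)
      (decide (P.CodesChain t x y u)) := by
  have hmul : (u.length + 1) * (2 * S + 8 * N + 20) ≤ (N + 1) * (2 * S + 8 * N + 20) :=
    Nat.mul_le_mul_right _ (by omega)
  refine (decides_readX (T := (N + 1) * (2 * S + 8 * N + 20) + 2 * S + 3 * N + 10)
    (x := x) (rest := encodeWords [y, u]) (by simp)
    ((decides_readY (y := y) (rest := encodeWords [u]) (by simp) ?_).mono
    (T := (N + 1) * (2 * S + 8 * N + 20) + 2 * S + 2 * N + 4 + y.length + 1) (by omega))).mono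
      (by rw [show N + 3 = N + 1 + 1 + 1 from rfl, add_mul (N + 1 + 1), add_mul (N + 1)]; omega)
  simp only [List.append_nil]
  refine (decides_copyZ_of_le (P := P) (S₁ := S) (S₂ := S)
    (T := (N + 1) * (2 * S + 8 * N + 20)) (M := 2 * N + 2)
    (hmem x hx) (fun h => hinc x h x h rfl hx) ?_ ?_ (fun hle => ?_) (fun hle => ?_)).mono
    (by omega)
  · rw [add_mul]
    omega
  · simp
    omega
  · have := decides_head (A := A) (P := P) (t := t) (par := true) hmem hinc hy hu hx
      (P.mem_left hle)
    rw [Bool.true_beq] at this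
    simpa using this.mono hmul
  · exact decide_eq_false fun h => hle (P.refl h.left_mem)

end ChainMachine

namespace WordPoset

variable {P : WordPoset}

open Polynomial in
/-- Codes of chains are recognized in polynomial time. -/
theorem polyTimeDecidable_codesChain (hmem : P.PolyTimeMembership) (hinc : P.PolyTimeIncidence)
    (t : Bool) :
    PolyTimeDecidable (fun q : (Word × Word) × Word => [q.1.1, q.1.2] ++ [q.2])
      (fun q => P.CodesChain t q.1.1 q.1.2 q.2) := by
  classical
  obtain ⟨hmem⟩ := hmem
  obtain ⟨hinc⟩ := hinc
  let A : Bool → TM2ComputableAux (Option Bool) Bool := fun i =>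
    bif i then hmem.toTM2ComputableAux else hinc.toTM2ComputableAux
  let S : ℕ[X] := hmem.time.comp (2 * X + 2) + hinc.time.comp (2 * X + 2)
  refine ⟨⟨⟨ChainMachine.machine A t, Equiv.refl _, Equiv.refl _⟩,
    (X + 3) * (2 * S + 8 * X + 20), fun q => Classical.choice ?_⟩⟩
  obtain ⟨⟨x, y⟩, u⟩ := q
  -- Pairs of words of length at most `N` make queries of length at most `2 * N + 2`.
  set N := (encodeWords ([x, y] ++ [u])).length with hN
  have hlen : N = x.length + y.length + u.length + 3 := by
    simp [hN]
    omega
  have h := ChainMachine.decides_readX_codesChain (A := A) (P := P) (t := t) (N := N)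
    (S := S.eval N) (x := x) (y := y) (u := u) ?_ ?_ (by omega) (by omega) (by omega)
  · have hinit : initList (ChainMachine.machine A t) (encodeWords ([x, y] ++ [u])) =
        ChainMachine.cfg A .readX false false
          ⟨encodeWords [x, y, u], [], [], [], [], [], [], []⟩ := by
      refine congrArg (TM2.Cfg.mk _ _) ?_
      refine (ChainMachine.initList_stk (ChainMachine.machine A t) _).trans ?_
      funext k
      rcases k with (_ | _ | _ | _ | _ | _) | ⟨i, k⟩
      all_goals try rfl
      by_cases hk : k = (A i).tm.k₀
      · subst hk
        cases i <;> simp [ChainMachine.Store.stk_input] <;> rfl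
      · cases i <;> simp [ChainMachine.Store.stk, ChainMachine.Store.stkWith,
          ChainMachine.Store.sub, hk] <;> rfl
    rw [← hinit] at h
    have htime : Polynomial.eval N ((X + 3) * (2 * S + 8 * X + 20)) =
        (N + 3) * (2 * S.eval N + 8 * N + 20) := by simp
    rw [← htime] at h
    exact (congrArg (fun l : List (Option Bool) => Nonempty (TM2OutputsInTime
      (ChainMachine.machine A t) l (some [decide (P.CodesChain t x y u)])
      (Polynomial.eval N ((X + 3) * (2 * S + 8 * X + 20))))) (List.map_id _)).mpr h
  · intro z hz
    refine ChainMachine.Answers.mono (T := hmem.time.eval (encodeWords [z]).length) ⟨?_⟩ ?_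
    · exact hmem.outputsFun z
    · refine (hmem.time.eval_mono_nat (b := 2 * N + 2) ?_).trans ?_
      · simp
        omega
      · simp [S]
  · intro w hw z hz hl hlz
    refine ChainMachine.Answers.mono (T := hinc.time.eval (encodeWords [w, z]).length) ⟨?_⟩ ?_
    · exact hinc.outputsFun ⟨(w, z), z.length, ⟨hw, hl⟩, hz, rfl⟩
    · refine (hinc.time.eval_mono_nat (b := 2 * N + 2) ?_).trans ?_
      · simp
        omega
      · simp [S]

open Polynomial in
/-- The numbers of even and of odd chains are in `#P`. -/
theorem inSharpP_chainCount (hheight : P.HasPolynomialHeight) (hmem : P.PolyTimeMembership)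
    (hinc : P.PolyTimeIncidence) (t : Bool) :
    InSharpP (fun q : Word × Word => [q.1, q.2]) (fun q => P.chainCount t q.1 q.2) := by
  obtain ⟨C, c, hC⟩ := hheight
  refine ⟨fun q u => P.CodesChain t q.1 q.2 u, (.C C * X ^ c * X : ℕ[X]),
    polyTimeDecidable_codesChain hmem hinc t, ?_, fun _ => rfl⟩
  rintro ⟨x, y⟩ u h
  have hle := CodesChain.length_le h
  simp only at hle
  rcases Nat.eq_zero_or_pos x.length with h0 | hpos
  · rw [h0, Nat.mul_zero] at hle
    omega
  · have hx : x.length ≤ (encodeWords [x, y]).length := by simp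
    simp only [Polynomial.eval_mul, Polynomial.eval_C, Polynomial.eval_pow, Polynomial.eval_X]
    calc u.length ≤ P.height x.length * x.length := hle
      _ ≤ C * x.length ^ c * x.length := Nat.mul_le_mul_right _ (hC _ hpos)
      _ ≤ _ := by gcongr

end WordPoset

end EffectiveMoebius

theorem proposition3p1 (P : EffectiveMoebius.WordPoset)
    (hheight : P.HasPolynomialHeight)
    (hmem : P.PolyTimeMembership)
    (hinc : P.PolyTimeIncidence)
    (μ : EffectiveMoebius.Word → EffectiveMoebius.Word → ℤ)
    (hμ : P.IsMoebiusInverse μ) :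
    EffectiveMoebius.InGapP
      (fun q : EffectiveMoebius.Word × EffectiveMoebius.Word => [q.1, q.2])
      (fun q => μ q.1 q.2) := by
  rw [P.isMoebiusInverse_unique hμ P.isMoebiusInverse_chainCount]
  exact ⟨_, _, EffectiveMoebius.WordPoset.inSharpP_chainCount hheight hmem hinc true,
    EffectiveMoebius.WordPoset.inSharpP_chainCount hheight hmem hinc false, fun _ => rfl⟩
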